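/- A \emph{disk-polygon} is a set $D\subset\mathbb{E}^2$ with non-empty interior that is the intersection of finitely many (at least one) closed unit disks, its \emph{generating disks}, each of which contributes to the boundary of $D$ through a circular arc of positive length (a side). It has \emph{center parameter} $d$ if the distance between any two centers of its generating disks is at most $d$. For $1\le d<\sqrt3$ let $\Delta(d)$ denote the intersection of the three closed unit disks centered at the vertices of a regular triangle of side length $d$ (unique up to congruence). The \emph{minimal width} $w(C)$ of a compact convex set $C\subset\mathbb{E}^2$ with non-empty interior is the smallest distance between two parallel supporting lines of $C$. Let $1\le d<\sqrt3$ and let $D$ be a disk-polygon with center parameter $d$. Then $$w(D)\ \ge\ w(\Delta(d))\ =\ 1-\tfrac12\sqrt{4+2d^2-2\sqrt3\,d\sqrt{4-d^2}}.$$ -/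

import Mathlib

open Metric

/-- The Euclidean plane. -/
abbrev Plane : Type := EuclideanSpace ℝ (Fin 2)

/-- The intersection of the closed unit disks centered at the points of `S`. -/
def diskInter (S : Set Plane) : Set Plane := ⋂ c ∈ S, closedBall c 1

/-- The closed unit disk centered at `c` contributes to the boundary of `D` through a circular
arc of positive length. -/
def ContributesArc (D : Set Plane) (c : Plane) : Prop :=
  ∃ x ∈ sphere c 1, ∃ ε > 0, sphere c 1 ∩ ball x ε ⊆ frontier D

/-- `D` is a disk-polygon whose generating disks are the closed unit disks centered at the
points of `S`: a finite intersection of unit disks with non-empty interior, to which every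
generating disk contributes a side. -/
structure IsDiskPolygonWithCenters (D S : Set Plane) : Prop where
  finite : S.Finite
  nonempty : S.Nonempty
  eq_inter : D = diskInter S
  interior_nonempty : (interior D).Nonempty
  needed : ∀ c ∈ S, ContributesArc D c

/-- The family of all disk-polygons with center parameter `d`: any two centers of generating
disks are at distance at most `d`. -/
def diskPolygonFamily (d : ℝ) : Set (Set Plane) :=
  {D | ∃ S : Set Plane, IsDiskPolygonWithCenters D S ∧ ∀ p ∈ S, ∀ q ∈ S, dist p q ≤ d}

/-- `T` is a regular disk-triangle `Δ(d)`: the intersection of the three closed unit disks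
centered at the vertices of a regular triangle of side length `d`. -/
def IsRegularDiskTriangle (d : ℝ) (T : Set Plane) : Prop :=
  ∃ a b c : Plane, dist a b = d ∧ dist b c = d ∧ dist c a = d ∧ T = diskInter {a, b, c}

/-- For a convex domain `C` and a unit vector `u`, the distance between the two supporting lines
of `C` that are orthogonal to `u`; these are the lines on which `inner ℝ u` is constantly equal
to its maximum, respectively its minimum, over `C`. -/
noncomputable def widthNormal (C : Set Plane) (u : Plane) : ℝ :=
  sSup ((fun x => inner ℝ u x) '' C) - sInf ((fun x => inner ℝ u x) '' C)

/-- The minimal width of a convex domain: the smallest distance between parallel supporting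
lines. -/
noncomputable def minimalWidth (C : Set Plane) : ℝ :=
  sInf (widthNormal C '' sphere (0 : Plane) 1)

/-! Write d = 2 sin θ with π/6 ≤ θ < π/3; the claimed width is w = 1 + cos θ − √3 sin θ. In a
direction u of minimal width t, some chord pq of length t is parallel to u (`exists_width_chord`),
so p and q are both extreme for u. At each of them u lies in the cone of at most two outer normals
(`exists_two_normals`). The corresponding centers lie on the unit circles around p and q, on both
sides of the line pq, and each pair spans an angle at most 2θ (`exists_normal_angles`).

It remains to rule out t < w for these four centers (`le_center_distance`). Two centers of different
circles on opposite sides of pq, both at angle at most θ, would be more than d apart. Hence each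
circle has one angle above θ, and both lie on the same side. If the two small angles have a small
sum, their centers are too far apart; otherwise the large angles can be enlarged until both pairs
span exactly 2θ, and averaging the two opposite distances bounds t from below.

For the regular disk-triangle the same bound applies, and the direction of an altitude of the center
triangle attains it. -/

open scoped Pointwise

/-! ### Trigonometry of the four contact centers -/

/-- The squared distance of opposite contact centers, bounded below over angles at most `θ`. -/
lemma opposite_centers_far {θ t α β : ℝ} (ht0 : 0 ≤ t) (hθ : θ ≤ Real.pi / 3)
    (ht : t < 1 + Real.cos θ - √3 * Real.sin θ) (hw : 1 + Real.cos θ - √3 * Real.sin θ ≤ 1)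
    (hα : 0 ≤ α) (hαθ : α ≤ θ) (hβ : 0 ≤ β) (hβθ : β ≤ θ) :
    4 * Real.sin θ ^ 2 <
      (t - Real.cos α - Real.cos β) ^ 2 + (Real.sin α + Real.sin β) ^ 2 := by
  wlog h : β ≤ α generalizing α β with H
  · have := H hβ hβθ hα hαθ (le_of_not_ge h)
    linarith
  have hpi := Real.pi_pos
  have h1 : Real.cos α ≤ Real.cos (α - β) :=
    Real.cos_le_cos_of_nonneg_of_le_pi (by linarith) (by linarith) (by linarith)
  have h2 : Real.cos θ ≤ Real.cos α :=
    Real.cos_le_cos_of_nonneg_of_le_pi (by linarith) (by linarith) (by linarith)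
  have h3 := Real.cos_le_one β
  rw [Real.cos_sub] at h1
  have hs3 : √3 ^ 2 = 3 := Real.sq_sqrt (by norm_num)
  have e1 := Real.sin_sq_add_cos_sq α
  have e2 := Real.sin_sq_add_cos_sq β
  have e3 := Real.sin_sq_add_cos_sq θ
  -- The worst case is α = θ, β = 0: the left side is (1 + cos θ − t)² + sin² θ.
  have h4 : 2 * (1 + Real.cos θ) * (1 - t) + t ^ 2 ≤
      (t - Real.cos α - Real.cos β) ^ 2 + (Real.sin α + Real.sin β) ^ 2 := by
    nlinarith [mul_nonneg ht0 (sub_nonneg.2 h3),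
      mul_nonneg (sub_nonneg.2 h2) (show 0 ≤ 1 - t by linarith)]
  refine lt_of_lt_of_le ?_ h4
  have h5 : (√3 * Real.sin θ) ^ 2 < (1 + Real.cos θ - t) ^ 2 := by
    apply pow_lt_pow_left₀ (by linarith) (by
      apply mul_nonneg (Real.sqrt_nonneg 3)
      exact Real.sin_nonneg_of_nonneg_of_le_pi (by linarith) (by linarith)) (by norm_num)
  rw [mul_pow, hs3] at h5
  nlinarith

/-- `α ↦ A cos α + B sin α` keeps decreasing once it has decreased, where it is nonnegative. -/
lemma sinusoid_le_of_lt {A B x y z : ℝ} (hxy : x < y) (hyz : y ≤ z) (hzx : z - x ≤ Real.pi)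
    (h0 : 0 ≤ A * Real.cos y + B * Real.sin y)
    (h : A * Real.cos y + B * Real.sin y ≤ A * Real.cos x + B * Real.sin x) :
    A * Real.cos z + B * Real.sin z ≤ A * Real.cos y + B * Real.sin y := by
  have hsy : 0 ≤ Real.sin (z - y) :=
    Real.sin_nonneg_of_nonneg_of_le_pi (by linarith) (by linarith)
  rcases eq_or_lt_of_le hyz with rfl | hyz'
  · exact le_rfl
  have hsx : 0 < Real.sin (y - x) :=
    Real.sin_pos_of_pos_of_lt_pi (by linarith) (by linarith)
  -- Three-point identity for sinusoids; it combines with the subadditivity of sine below.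
  have key : (A * Real.cos z + B * Real.sin z) * Real.sin (y - x) =
      (A * Real.cos y + B * Real.sin y) * Real.sin (z - x) -
        (A * Real.cos x + B * Real.sin x) * Real.sin (z - y) := by
    simp only [Real.sin_sub]
    ring
  have hadd : Real.sin (z - x) ≤ Real.sin (z - y) + Real.sin (y - x) := by
    have : z - x = (z - y) + (y - x) := by ring
    rw [this, Real.sin_add]
    nlinarith [Real.cos_le_one (z - y), Real.cos_le_one (y - x)]
  refine le_of_mul_le_mul_right ?_ hsx
  rw [key]
  nlinarith [mul_le_mul_of_nonneg_left hadd h0, mul_le_mul_of_nonneg_right h hsy]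

/-- Pushing one of two opposite contact centers outward keeps them close. -/
lemma opposite_centers_close_of_push {θ t α β γ : ℝ} (ht0 : 0 ≤ t) (ht1 : t ≤ 1)
    (hθ : θ ≤ Real.pi / 3) (hθα : θ < α) (hαγ : α ≤ γ) (hγ : γ ≤ 2 * θ)
    (hβ : 0 ≤ β) (hβθ : β ≤ θ) (hαβ : α - β ≤ Real.pi / 2) {K : ℝ}
    (h1 : K < (t - Real.cos θ - Real.cos β) ^ 2 + (Real.sin θ + Real.sin β) ^ 2)
    (h2 : (t - Real.cos α - Real.cos β) ^ 2 + (Real.sin α + Real.sin β) ^ 2 ≤ K) :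
    (t - Real.cos γ - Real.cos β) ^ 2 + (Real.sin γ + Real.sin β) ^ 2 ≤ K := by
  have hpi := Real.pi_pos
  have e1 := Real.sin_sq_add_cos_sq α
  have e3 := Real.sin_sq_add_cos_sq θ
  have e4 := Real.sin_sq_add_cos_sq γ
  -- As a function of α, the squared distance is a constant plus twice this sinusoid, which equals
  -- cos (α − β) − t cos α.
  have hn : 0 ≤ (Real.cos β - t) * Real.cos α + Real.sin β * Real.sin α := by
    have h3 : 0 ≤ Real.cos (α - β) :=
      Real.cos_nonneg_of_neg_pi_div_two_le_of_le (by linarith) hαβ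
    have h4 : Real.cos α ≤ Real.cos (α - β) :=
      Real.cos_le_cos_of_nonneg_of_le_pi (by linarith) (by linarith) (by linarith)
    rw [Real.cos_sub] at h3 h4
    rcases le_total 0 (Real.cos α) with h | h
    · nlinarith [mul_nonneg h (sub_nonneg.2 ht1)]
    · nlinarith [mul_nonneg_of_nonpos_of_nonpos h (neg_nonpos.2 ht0)]
  have := sinusoid_le_of_lt hθα hαγ (by linarith) hn (by nlinarith)
  nlinarith

/-- The right side is 2 cos (θ + π/6), the bound that both cases of `le_center_distance` produce.
Since sin θ and cos θ are at least 1/2, (sin θ − 1/2)(cos θ − 1/2) ≥ 0 forces sin θ + cos θ ≥ (√3 +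
1)/2. -/
lemma one_add_two_cos_le {θ : ℝ} (hθ1 : Real.pi / 6 ≤ θ) (hθ2 : θ ≤ Real.pi / 3) :
    1 + Real.cos θ - √3 * Real.sin θ ≤ √3 * Real.cos θ - Real.sin θ := by
  have hs3 : √3 ^ 2 = 3 := Real.sq_sqrt (by norm_num)
  have hp : 0 < √3 := by positivity
  have hpi := Real.pi_pos
  have hc : 1 / 2 ≤ Real.cos θ := by
    rw [← Real.cos_pi_div_three]
    exact Real.cos_le_cos_of_nonneg_of_le_pi (by linarith) (by linarith) hθ2
  have hs : 1 / 2 ≤ Real.sin θ := by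
    rw [← Real.sin_pi_div_six]
    exact Real.sin_le_sin_of_le_of_le_pi_div_two (by linarith) (by linarith) hθ1
  have h1 : 1 < √3 := by nlinarith
  have e := Real.sin_sq_add_cos_sq θ
  have key : √3 + 1 ≤ 2 * (Real.sin θ + Real.cos θ) := by
    have h0 : 0 ≤ (Real.sin θ - 1 / 2) * (Real.cos θ - 1 / 2) := by
      apply mul_nonneg <;> linarith
    nlinarith
  nlinarith

lemma width_le_one {θ : ℝ} (hθ1 : Real.pi / 6 ≤ θ) (hθ2 : θ ≤ Real.pi / 3) :
    1 + Real.cos θ - √3 * Real.sin θ ≤ 1 := by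
  have hs3 : √3 ^ 2 = 3 := Real.sq_sqrt (by norm_num)
  have hp : 0 < √3 := by positivity
  have hpi := Real.pi_pos
  have hc : Real.cos θ ≤ √3 / 2 := by
    rw [← Real.cos_pi_div_six]
    exact Real.cos_le_cos_of_nonneg_of_le_pi (by linarith) (by linarith) hθ1
  have hs : 1 / 2 ≤ Real.sin θ := by
    rw [← Real.sin_pi_div_six]
    exact Real.sin_le_sin_of_le_of_le_pi_div_two (by linarith) (by linarith) hθ1
  nlinarith

/-- Let two unit circles have centers at distance `t` on a line, with two points on each of
them at angles `α₁, α₂` (`β₁, β₂`) to both sides of that line. If all the distances between points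
of different circles are at most `2 sin θ`, then `t` is at least the width of the regular
disk-triangle. -/
lemma le_center_distance {θ t α₁ α₂ β₁ β₂ : ℝ} (hθ1 : Real.pi / 6 ≤ θ) (hθ2 : θ < Real.pi / 3)
    (ht0 : 0 ≤ t) (hα₁ : 0 ≤ α₁) (hα₂ : 0 ≤ α₂) (hβ₁ : 0 ≤ β₁) (hβ₂ : 0 ≤ β₂)
    (hα : α₁ + α₂ ≤ 2 * θ) (hβ : β₁ + β₂ ≤ 2 * θ)
    (h11 : (t - Real.cos α₁ - Real.cos β₁) ^ 2 + (Real.sin α₁ + Real.sin β₁) ^ 2 ≤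
      4 * Real.sin θ ^ 2)
    (h22 : (t - Real.cos α₂ - Real.cos β₂) ^ 2 + (Real.sin α₂ + Real.sin β₂) ^ 2 ≤
      4 * Real.sin θ ^ 2)
    (h12 : (t - Real.cos α₁ - Real.cos β₂) ^ 2 + (Real.sin α₁ - Real.sin β₂) ^ 2 ≤
      4 * Real.sin θ ^ 2)
    (h21 : (t - Real.cos α₂ - Real.cos β₁) ^ 2 + (Real.sin α₂ - Real.sin β₁) ^ 2 ≤
      4 * Real.sin θ ^ 2) :
    1 + Real.cos θ - √3 * Real.sin θ ≤ t := by
  have hpi := Real.pi_pos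
  wlog h : α₁ ≤ α₂ generalizing α₁ α₂ β₁ β₂ with H
  · exact H hα₂ hα₁ hβ₂ hβ₁ (by linarith) (by linarith) h22 h11 h21 h12 (le_of_not_ge h)
  by_contra! hlt
  have hw := width_le_one hθ1 hθ2.le
  have far : ∀ {α β : ℝ}, 0 ≤ α → α ≤ θ → 0 ≤ β → β ≤ θ → 4 * Real.sin θ ^ 2 <
      (t - Real.cos α - Real.cos β) ^ 2 + (Real.sin α + Real.sin β) ^ 2 :=
    fun ha hb hc hd => opposite_centers_far ht0 hθ2.le hlt hw ha hb hc hd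
  have hα₁θ : α₁ ≤ θ := by linarith
  have hβ₁θ : θ < β₁ := by
    by_contra! hc
    linarith [far hα₁ hα₁θ hβ₁ hc]
  have hβ₂θ : β₂ ≤ θ := by linarith
  have hα₂θ : θ < α₂ := by
    by_contra! hc
    linarith [far hα₂ hc hβ₂ hβ₂θ]
  have hw2 := one_add_two_cos_le hθ1 hθ2.le
  have hsθ : 0 ≤ Real.sin θ := Real.sin_nonneg_of_nonneg_of_le_pi (by linarith) (by linarith)
  -- The small angles α₁, β₂ lie on the same side. The threshold makes δ ≤ θ − π/6 in one case and e
  -- ≤ π/6 in the other.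
  rcases le_total (α₁ + β₂) (2 * θ - Real.pi / 3) with hsum | hsum
  · set δ := (α₁ + β₂) / 2 with hδ
    set μ := (α₁ - β₂) / 2 with hμ
    have ea : α₁ = δ + μ := by rw [hδ, hμ]; ring
    have eb : β₂ = δ - μ := by rw [hδ, hμ]; ring
    have hδ1 : Real.cos (θ - Real.pi / 6) ≤ Real.cos δ :=
      Real.cos_le_cos_of_nonneg_of_le_pi (by linarith) (by linarith) (by linarith)
    rw [Real.cos_sub, Real.cos_pi_div_six, Real.sin_pi_div_six] at hδ1
    rw [ea, eb, Real.cos_add, Real.cos_sub, Real.sin_add, Real.sin_sub] at h12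
    have e1 := Real.sin_sq_add_cos_sq δ
    have e2 := Real.sin_sq_add_cos_sq μ
    have hcδ : 0 ≤ Real.cos δ :=
      Real.cos_nonneg_of_neg_pi_div_two_le_of_le (by linarith) (by linarith)
    -- The asymmetry μ enters `h12` only through cos μ ≤ 1, so the symmetric position is extremal.
    have h5 : (2 * Real.cos δ - t) ^ 2 ≤ (2 * Real.sin θ) ^ 2 := by
      have h6 := mul_nonneg (mul_nonneg ht0 hcδ) (sub_nonneg.2 (Real.cos_le_one μ))
      have h7 : (t - (Real.cos δ * Real.cos μ - Real.sin δ * Real.sin μ) -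
          (Real.cos δ * Real.cos μ + Real.sin δ * Real.sin μ)) ^ 2 +
          (Real.sin δ * Real.cos μ + Real.cos δ * Real.sin μ -
          (Real.sin δ * Real.cos μ - Real.cos δ * Real.sin μ)) ^ 2 =
          t ^ 2 - 4 * t * (Real.cos δ * Real.cos μ) + 4 * Real.cos δ ^ 2 *
            (Real.sin μ ^ 2 + Real.cos μ ^ 2) := by ring
      rw [h7, e2] at h12
      nlinarith
    have h8 := abs_le_of_sq_le_sq' h5 (by linarith)
    linarith [h8.1, h8.2]
  -- Enlarge α₂ and β₁ until both pairs span exactly 2θ; `hsum` gives α₂ − β₂ ≤ π/3 and β₁ − α₁ ≤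
  -- π/3.
  · have h1 := opposite_centers_close_of_push (γ := 2 * θ - α₁) ht0 (by linarith)
      hθ2.le hα₂θ (by linarith) (by linarith) hβ₂ hβ₂θ (by linarith)
      (far (by linarith) le_rfl hβ₂ hβ₂θ) h22
    have h2 := opposite_centers_close_of_push (γ := 2 * θ - β₂) (t := t) (β := α₁)
      (K := 4 * Real.sin θ ^ 2) ht0 (by linarith)
      hθ2.le hβ₁θ (by linarith) (by linarith) hα₁ hα₁θ (by linarith)
      (far (by linarith) le_rfl hα₁ hα₁θ) (by linarith)
    set e := θ - (α₁ + β₂) / 2 with he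
    set μ := (α₁ - β₂) / 2 with hμ
    have ea : 2 * θ - α₁ = θ + (e - μ) := by rw [he, hμ]; ring
    have eb : 2 * θ - β₂ = θ + (e + μ) := by rw [he, hμ]; ring
    have ec : α₁ = θ - (e - μ) := by rw [he, hμ]; ring
    have ed : β₂ = θ - (e + μ) := by rw [he, hμ]; ring
    rw [ea, ed] at h1
    rw [eb, ec] at h2
    have e1 := Real.sin_sq_add_cos_sq e
    have e2 := Real.sin_sq_add_cos_sq μ
    have e3 := Real.sin_sq_add_cos_sq θ
    have he0 : 0 ≤ e := by linarith
    have he6 : e ≤ Real.pi / 6 := by linarith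
    have hce : 0 ≤ Real.cos e :=
      Real.cos_nonneg_of_neg_pi_div_two_le_of_le (by linarith) (by linarith)
    have hse : 0 ≤ Real.sin e :=
      Real.sin_nonneg_of_nonneg_of_le_pi (by linarith) (by linarith)
    have hcθ : 0 ≤ Real.cos θ :=
      Real.cos_nonneg_of_neg_pi_div_two_le_of_le (by linarith) (by linarith)
    have h9 : ∀ x y : ℝ, (t - Real.cos x - Real.cos y) ^ 2 + (Real.sin x + Real.sin y) ^ 2 =
        2 + t ^ 2 - 2 * t * (Real.cos x + Real.cos y) + 2 * Real.cos (x - y) := by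
      intro x y
      rw [Real.cos_sub]
      linear_combination Real.sin_sq_add_cos_sq x + Real.sin_sq_add_cos_sq y
    rw [h9] at h1 h2
    rw [show θ + (e - μ) - (θ - (e + μ)) = 2 * e by ring] at h1
    rw [show θ + (e + μ) - (θ - (e - μ)) = 2 * e by ring] at h2
    simp only [Real.cos_add, Real.cos_sub, Real.sin_add, Real.sin_sub, Real.cos_two_mul] at h1 h2
    -- Averaging `h1` and `h2` leaves μ only in a factor cos μ ≤ 1; the result yields t ≥ 2 cos (θ +
    -- e).
    have h3 : (2 * (Real.cos θ * Real.cos e) - t) ^ 2 ≤ (2 * (Real.sin θ * Real.sin e)) ^ 2 := by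
      have h6 := mul_nonneg (mul_nonneg ht0 (mul_nonneg hcθ hce))
        (sub_nonneg.2 (Real.cos_le_one μ))
      have h7 : 4 * Real.cos e ^ 2 - 4 * t * (Real.cos θ * Real.cos e) * Real.cos μ + t ^ 2 ≤
          4 * Real.sin θ ^ 2 := by linarith
      have h10 : (2 * (Real.sin θ * Real.sin e)) ^ 2 = 4 * Real.sin θ ^ 2 -
          4 * Real.cos e ^ 2 + (2 * (Real.cos θ * Real.cos e)) ^ 2 := by
        have : Real.sin θ ^ 2 = 1 - Real.cos θ ^ 2 := by linarith
        have h11 : Real.sin e ^ 2 = 1 - Real.cos e ^ 2 := by linarith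
        rw [mul_pow, mul_pow, this, h11]; ring
      rw [h10]
      linear_combination h7 + 4 * h6
    have h8 := abs_le_of_sq_le_sq' h3 (by positivity)
    have h10 : Real.cos (θ + Real.pi / 6) ≤ Real.cos (θ + e) :=
      Real.cos_le_cos_of_nonneg_of_le_pi (by linarith) (by linarith) (by linarith)
    rw [Real.cos_add, Real.cos_add, Real.cos_pi_div_six, Real.sin_pi_div_six] at h10
    linarith [h8.1, h8.2]

/-! ### Outer normals at extreme points -/

lemma mem_diskInter {S : Set Plane} {x : Plane} : x ∈ diskInter S ↔ ∀ c ∈ S, dist x c ≤ 1 := by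
  simp [diskInter]

/-- At a point of an intersection of unit disks that is extreme in the direction `u`, the vector `u`
is a nonnegative combination of at most two outer normals of the disks. -/
lemma exists_two_normals {S : Set Plane} (hS : S.Finite) {o p u : Plane}
    (ho : ∀ c ∈ S, dist o c < 1) (hp : p ∈ diskInter S) (hu : u ≠ 0)
    (hmax : ∀ x ∈ diskInter S, inner ℝ u x ≤ inner ℝ u p) :
    ∃ c₁ ∈ S, ∃ c₂ ∈ S, dist p c₁ = 1 ∧ dist p c₂ = 1 ∧
      ∃ a b : ℝ, 0 ≤ a ∧ 0 ≤ b ∧ a • (p - c₁) + b • (p - c₂) = u := by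
  classical
  rw [mem_diskInter] at hp
  set N : Set Plane := (fun c => p - c) '' {c ∈ S | dist p c = 1} with hN
  have hNfin : N.Finite := (hS.subset (Set.sep_subset _ _)).image _
  have hNo : ∀ n ∈ N, inner ℝ n (o - p) < 0 := by
    rintro _ ⟨c, ⟨hc, hpc⟩, rfl⟩
    have h1 := ho c hc
    rw [dist_eq_norm] at h1 hpc
    have h2 : ‖o - c‖ ^ 2 = ‖p - c‖ ^ 2 + 2 * inner ℝ (p - c) (o - p) + ‖o - p‖ ^ 2 := by
      rw [← norm_add_sq_real]; congr 2; abel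
    show inner ℝ (p - c) (o - p) < 0
    nlinarith [norm_nonneg (o - c), sq_nonneg ‖o - p‖]
  -- Otherwise a separating vector z gives a direction −z that stays in every disk for a short time
  -- and strictly increases `inner ℝ u`.
  have hmem : (0 : Plane) ∈ convexHull ℝ (insert (-u) N) := by
    by_contra h0
    obtain ⟨f, r, hf0, hf⟩ := geometric_hahn_banach_point_closed (convex_convexHull ℝ _)
      ((hNfin.insert (-u)).isClosed_convexHull (𝕜 := ℝ)) h0
    rw [map_zero] at hf0
    set z : Plane := (InnerProductSpace.toDual ℝ Plane).symm f with hz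
    have hfz : ∀ x, f x = inner ℝ z x := fun x => by
      rw [hz, InnerProductSpace.toDual_symm_apply]
    have hfu : inner ℝ z u < 0 := by
      have := hf (-u) (subset_convexHull ℝ _ (Set.mem_insert _ _))
      rw [hfz, inner_neg_right] at this
      linarith
    have hfn : ∀ n ∈ N, 0 < inner ℝ z n := fun n hn => by
      have := hf n (subset_convexHull ℝ _ (Set.mem_insert_of_mem _ hn))
      rw [hfz] at this
      linarith
    have hev : ∀ᶠ ε in nhdsWithin (0 : ℝ) (Set.Ioi 0), ∀ c ∈ S, dist (p - ε • z) c ≤ 1 := by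
      rw [Filter.eventually_all_finite hS]
      intro c hc
      rcases (hp c hc).lt_or_eq with hlt | heq
      · have hcont : Continuous fun ε : ℝ => dist (p - ε • z) c := by fun_prop
        have h3 : ∀ᶠ ε in nhds (0 : ℝ), dist (p - ε • z) c < 1 :=
          hcont.continuousAt.eventually_lt_const (by simpa using hlt)
        exact (h3.filter_mono nhdsWithin_le_nhds).mono fun _ h => h.le
      · have hn := hfn (p - c) ⟨c, ⟨hc, heq⟩, rfl⟩
        have hcont : Continuous fun ε : ℝ => ε * ‖z‖ ^ 2 := by fun_prop
        have h3 : ∀ᶠ ε in nhds (0 : ℝ), ε * ‖z‖ ^ 2 < inner ℝ z (p - c) :=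
          hcont.continuousAt.eventually_lt_const (by simpa using hn)
        filter_upwards [h3.filter_mono nhdsWithin_le_nhds, self_mem_nhdsWithin] with ε h4 h5
        rw [Set.mem_Ioi] at h5
        rw [dist_eq_norm] at heq ⊢
        have h6 : ‖p - ε • z - c‖ ^ 2 = 1 - 2 * (ε * inner ℝ z (p - c)) + ε ^ 2 * ‖z‖ ^ 2 := by
          rw [show p - ε • z - c = (p - c) - ε • z by abel, norm_sub_sq_real, heq, inner_smul_right,
            real_inner_comm, norm_smul, mul_pow, Real.norm_eq_abs, sq_abs]
          norm_num
        have h7 : ‖p - ε • z - c‖ ^ 2 ≤ 1 ^ 2 := by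
          rw [h6]
          nlinarith [mul_pos h5 hn]
        exact (sq_le_sq₀ (norm_nonneg _) (by norm_num)).1 h7
    obtain ⟨ε, h1, h2⟩ := (hev.and self_mem_nhdsWithin).exists
    have h3 := hmax _ (mem_diskInter.2 h1)
    rw [inner_sub_right, inner_smul_right] at h3
    rw [real_inner_comm] at hfu
    have h2' : 0 < ε := h2
    nlinarith [mul_neg_of_pos_of_neg h2' hfu]
  -- Carathéodory: at most three points. One of them is −u, since all normals have negative inner
  -- product with o − p; at most two normals remain.
  obtain ⟨ι, _, z, w, hzr, hind, hw, hw1, hsum⟩ := eq_pos_convex_span_of_mem_convexHull hmem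
  have hcard : Fintype.card ι ≤ 3 := by
    have := hind.card_le_finrank_succ
    have h2 : Module.finrank ℝ (vectorSpan ℝ (Set.range z)) ≤ Module.finrank ℝ Plane :=
      Submodule.finrank_le _
    rw [finrank_euclideanSpace_fin] at h2
    omega
  obtain ⟨i₀, hi₀⟩ : ∃ i, z i ∉ N := by
    by_contra! hall
    have h1 : inner ℝ (∑ i, w i • z i) (o - p) = 0 := by rw [hsum, inner_zero_left]
    rw [sum_inner] at h1
    have h2 : ∀ i, inner ℝ (w i • z i) (o - p) < 0 := fun i => by
      rw [real_inner_smul_left]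
      exact mul_neg_of_pos_of_neg (hw i) (hNo _ (hall i))
    rcases isEmpty_or_nonempty ι with he | ⟨⟨i⟩⟩
    · simp at hw1
    · exact absurd h1 (Finset.sum_neg (fun i _ => h2 i) ⟨i, Finset.mem_univ i⟩).ne
  have hzu : z i₀ = -u := (hzr ⟨i₀, rfl⟩).resolve_right hi₀
  have hzN : ∀ i ∈ Finset.univ.erase i₀, z i ∈ N := fun i hi =>
    (hzr ⟨i, rfl⟩).resolve_left fun h => Finset.ne_of_mem_erase hi (hind.injective (h.trans hzu.symm))
  have hsum' : ∑ i ∈ Finset.univ.erase i₀, w i • z i = w i₀ • u := by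
    have := Finset.add_sum_erase Finset.univ (fun i => w i • z i) (Finset.mem_univ i₀)
    rw [hsum, hzu, smul_neg, neg_add_eq_zero] at this
    exact this.symm
  have hdiv : ∀ a b : ℝ, ∀ x y : Plane, a • x + b • y = w i₀ • u →
      (a / w i₀) • x + (b / w i₀) • y = u := by
    intro a b x y h
    rw [div_eq_inv_mul, div_eq_inv_mul, mul_smul, mul_smul, ← smul_add, h, smul_smul,
      inv_mul_cancel₀ (hw i₀).ne', one_smul]
  have hc2 : (Finset.univ.erase i₀).card ≤ 2 := by
    rw [Finset.card_erase_of_mem (Finset.mem_univ _), Finset.card_univ]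
    omega
  interval_cases hk : (Finset.univ.erase i₀).card
  · rw [Finset.card_eq_zero.1 hk, Finset.sum_empty] at hsum'
    exact absurd hsum'.symm (smul_ne_zero (hw i₀).ne' hu)
  · obtain ⟨i, hi⟩ := Finset.card_eq_one.1 hk
    rw [hi] at hzN hsum'
    rw [Finset.sum_singleton] at hsum'
    obtain ⟨c, ⟨hc, hpc⟩, hzc⟩ := hzN i (by simp)
    refine ⟨c, hc, c, hc, hpc, hpc, w i / w i₀, 0 / w i₀, (div_pos (hw _) (hw _)).le, by simp,
      hdiv _ _ _ _ ?_⟩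
    rw [zero_smul, add_zero, ← hsum', ← hzc]
  · obtain ⟨i, j, hij, hi⟩ := Finset.card_eq_two.1 hk
    rw [hi] at hzN hsum'
    rw [Finset.sum_pair hij] at hsum'
    obtain ⟨c, ⟨hc, hpc⟩, hzc⟩ := hzN i (by simp)
    obtain ⟨c', ⟨hc', hpc'⟩, hzc'⟩ := hzN j (by simp)
    refine ⟨c, hc, c', hc', hpc, hpc', w i / w i₀, w j / w i₀, (div_pos (hw _) (hw _)).le,
      (div_pos (hw _) (hw _)).le, hdiv _ _ _ _ ?_⟩
    rw [← hsum', ← hzc, ← hzc']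

/-- The quarter turn of the plane. -/
def quarterTurn (u : Plane) : Plane := !₂[-u 1, u 0]

lemma plane_inner (x y : Plane) : inner ℝ x y = x 0 * y 0 + x 1 * y 1 := by
  simp [PiLp.inner_apply, Fin.sum_univ_two, mul_comm]

lemma plane_norm_sq (x : Plane) : ‖x‖ ^ 2 = x 0 ^ 2 + x 1 ^ 2 := by
  simp [EuclideanSpace.norm_sq_eq, Fin.sum_univ_two]

lemma quarterTurn_neg (u : Plane) : quarterTurn (-u) = -quarterTurn u := by
  ext i; fin_cases i <;> simp [quarterTurn]

lemma inner_quarterTurn_self (u : Plane) : inner ℝ (quarterTurn u) u = 0 := by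
  simp [plane_inner, quarterTurn]; ring

lemma inner_self_of_unit {u : Plane} (hu : ‖u‖ = 1) : inner ℝ u u = (1 : ℝ) := by
  rw [real_inner_self_eq_norm_sq, hu, one_pow]

/-- The inner product in the orthonormal frame `u, quarterTurn u`. -/
lemma inner_eq_frame {u : Plane} (hu : ‖u‖ = 1) (x y : Plane) :
    inner ℝ x y = inner ℝ u x * inner ℝ u y +
      inner ℝ (quarterTurn u) x * inner ℝ (quarterTurn u) y := by
  have h := plane_norm_sq u
  rw [hu] at h
  simp only [plane_inner, quarterTurn, Matrix.cons_val_zero, Matrix.cons_val_one]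
  linear_combination (x 0 * y 0 + x 1 * y 1) * h

lemma norm_sq_eq_frame {u : Plane} (hu : ‖u‖ = 1) (x : Plane) :
    ‖x‖ ^ 2 = inner ℝ u x ^ 2 + inner ℝ (quarterTurn u) x ^ 2 := by
  rw [← real_inner_self_eq_norm_sq, inner_eq_frame hu]; ring

/-- Angles of the two outer normals at an extreme point, measured from the direction `u` to
both sides. -/
lemma exists_normal_angles {S : Set Plane} (hS : S.Finite) {θ : ℝ} (hθ0 : 0 ≤ θ)
    (hd : ∀ c ∈ S, ∀ c' ∈ S, dist c c' ≤ 2 * Real.sin θ)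
    {o p u : Plane} (ho : ∀ c ∈ S, dist o c < 1) (hp : p ∈ diskInter S) (hu : ‖u‖ = 1)
    (hmax : ∀ x ∈ diskInter S, inner ℝ u x ≤ inner ℝ u p) :
    ∃ c₁ ∈ S, ∃ c₂ ∈ S, ∃ α₁ α₂ : ℝ, 0 ≤ α₁ ∧ 0 ≤ α₂ ∧ α₁ + α₂ ≤ 2 * θ ∧
      inner ℝ u (p - c₁) = Real.cos α₁ ∧ inner ℝ (quarterTurn u) (p - c₁) = Real.sin α₁ ∧
      inner ℝ u (p - c₂) = Real.cos α₂ ∧ inner ℝ (quarterTurn u) (p - c₂) = -Real.sin α₂ := by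
  have hu0 : u ≠ 0 := by
    rintro rfl; simp at hu
  obtain ⟨c₁, h₁, c₂, h₂, hn₁, hn₂, a, b, ha, hb, hab⟩ := exists_two_normals hS ho hp hu0 hmax
  rw [dist_eq_norm] at hn₁ hn₂
  wlog hs : 0 ≤ inner ℝ (quarterTurn u) (p - c₁) ∧ inner ℝ (quarterTurn u) (p - c₂) ≤ 0
    generalizing c₁ c₂ a b with H
  -- The components orthogonal to u cancel, so the normals lie on different sides and a swap
  -- suffices, unless a weight vanishes and a normal equals u.
  · have h0 : a * inner ℝ (quarterTurn u) (p - c₁) + b * inner ℝ (quarterTurn u) (p - c₂) = 0 := by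
      rw [← inner_smul_right, ← inner_smul_right, ← inner_add_right, hab, inner_quarterTurn_self]
    have hself : ∀ c ∈ S, ∀ r : ℝ, 0 ≤ r → ‖p - c‖ = 1 → r • (p - c) = u → ∃ c₁ ∈ S, ∃ c₂ ∈ S,
        ∃ α₁ α₂ : ℝ, 0 ≤ α₁ ∧ 0 ≤ α₂ ∧ α₁ + α₂ ≤ 2 * θ ∧
        inner ℝ u (p - c₁) = Real.cos α₁ ∧ inner ℝ (quarterTurn u) (p - c₁) = Real.sin α₁ ∧
        inner ℝ u (p - c₂) = Real.cos α₂ ∧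
        inner ℝ (quarterTurn u) (p - c₂) = -Real.sin α₂ := by
      intro c hc r hr hn hru
      have hr1 : r = 1 := by
        have := congrArg norm hru
        rwa [norm_smul, hn, hu, mul_one, Real.norm_of_nonneg hr] at this
      rw [hr1, one_smul] at hru
      exact ⟨c, hc, c, hc, 0, 0, le_rfl, le_rfl, by linarith, by
        simp [hru, hu], by simp [hru, inner_quarterTurn_self], by simp [hru, hu],
        by simp [hru, inner_quarterTurn_self]⟩
    rcases ha.eq_or_lt with ha0 | ha0
    · exact hself c₂ h₂ b hb hn₂ (by rw [← hab, ← ha0, zero_smul, zero_add])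
    rcases hb.eq_or_lt with hb0 | hb0
    · exact hself c₁ h₁ a ha hn₁ (by rw [← hab, ← hb0, zero_smul, add_zero])
    rw [not_and_or, not_le, not_le] at hs
    refine H c₂ h₂ c₁ h₁ hn₂ hn₁ b a hb ha (by rw [← hab, add_comm]) ?_
    rcases hs with hs | hs <;> constructor <;> by_contra! hc <;>
      nlinarith [mul_pos ha0 hb0]
  have hangle : ∀ n : Plane, ‖n‖ = 1 → inner ℝ u n = Real.cos (Real.arccos (inner ℝ u n)) ∧
      |inner ℝ (quarterTurn u) n| = Real.sin (Real.arccos (inner ℝ u n)) := by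
    intro n hn
    have h1 := norm_sq_eq_frame hu n
    rw [hn] at h1
    have h2 : inner ℝ u n ^ 2 ≤ 1 ^ 2 := by nlinarith [sq_nonneg (inner ℝ (quarterTurn u) n)]
    have h3 := abs_le_of_sq_le_sq' h2 (by norm_num)
    refine ⟨(Real.cos_arccos h3.1 h3.2).symm, ?_⟩
    rw [Real.sin_arccos, ← Real.sqrt_sq_eq_abs]
    congr 1
    linarith
  obtain ⟨hc₁, hs₁⟩ := hangle _ hn₁
  obtain ⟨hc₂, hs₂⟩ := hangle _ hn₂
  rw [abs_of_nonneg hs.1] at hs₁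
  rw [abs_of_nonpos hs.2] at hs₂
  set α₁ := Real.arccos (inner ℝ u (p - c₁)) with hα₁
  set α₂ := Real.arccos (inner ℝ u (p - c₂)) with hα₂
  have hα₁0 : 0 ≤ α₁ := Real.arccos_nonneg _
  have hα₂0 : 0 ≤ α₂ := Real.arccos_nonneg _
  have hα₁p : α₁ ≤ Real.pi := Real.arccos_le_pi _
  have hα₂p : α₂ ≤ Real.pi := Real.arccos_le_pi _
  refine ⟨c₁, h₁, c₂, h₂, α₁, α₂, hα₁0, hα₂0, ?_, hc₁, hs₁, hc₂, by linarith⟩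
  have hn12 : inner ℝ (p - c₁) (p - c₂) = Real.cos (α₁ + α₂) := by
    rw [inner_eq_frame hu, hc₁, hc₂, hs₁, Real.cos_add, ← hs₂]; ring
  -- The sum is (a + b)(1 + cos (α₁ + α₂)); its sign excludes α₁ + α₂ > π, so the chord length
  -- controls the angle.
  have hsum0 : 0 ≤ Real.cos α₁ + Real.cos α₂ := by
    have e1 : inner ℝ u (p - c₁) = a + b * Real.cos (α₁ + α₂) := by
      rw [← hn12]
      nth_rw 1 [← hab]
      rw [inner_add_left, real_inner_smul_left, real_inner_smul_left, inner_self_of_unit hn₁,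
        real_inner_comm (p - c₁) (p - c₂)]
      ring
    have e2 : inner ℝ u (p - c₂) = a * Real.cos (α₁ + α₂) + b := by
      rw [← hn12]
      nth_rw 1 [← hab]
      rw [inner_add_left, real_inner_smul_left, real_inner_smul_left, inner_self_of_unit hn₂]
      ring
    rw [← hc₁, ← hc₂, e1, e2]
    nlinarith [Real.neg_one_le_cos (α₁ + α₂)]
  have hpi : α₁ + α₂ ≤ Real.pi := by
    by_contra! hlt
    have : Real.cos α₂ < Real.cos (Real.pi - α₁) :=
      Real.cos_lt_cos_of_nonneg_of_le_pi (by linarith) (by linarith) (by linarith)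
    rw [Real.cos_pi_sub] at this
    linarith
  by_contra! hlt
  have h3 : Real.cos (α₁ + α₂) < Real.cos (2 * θ) :=
    Real.cos_lt_cos_of_nonneg_of_le_pi (by linarith) hpi hlt
  have h4 := hd _ h₁ _ h₂
  have h5 : dist c₁ c₂ ^ 2 = 2 - 2 * Real.cos (α₁ + α₂) := by
    rw [dist_eq_norm, show c₁ - c₂ = (p - c₂) - (p - c₁) by abel, norm_sub_sq_real, hn₁, hn₂,
      real_inner_comm, hn12]
    ring
  rw [Real.cos_two_mul] at h3
  have h6 := Real.sin_sq_add_cos_sq θ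
  nlinarith [dist_nonneg (x := c₁) (y := c₂)]

/-! ### Chords in directions of minimal width -/

lemma isCompact_diskInter {S : Set Plane} (hS : S.Nonempty) : IsCompact (diskInter S) := by
  obtain ⟨c, hc⟩ := hS
  exact (isCompact_closedBall c 1).of_isClosed_subset
    (isClosed_biInter fun _ _ => isClosed_closedBall) (Set.biInter_subset_of_mem hc)

lemma convex_diskInter (S : Set Plane) : Convex ℝ (diskInter S) :=
  convex_iInter₂ fun c _ => convex_closedBall c 1

/-- The width in a direction is the difference of the values at two extreme points. -/
lemma exists_extreme_points {D : Set Plane} (hD : IsCompact D) (hne : D.Nonempty) (u : Plane) :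
    ∃ p ∈ D, ∃ q ∈ D, widthNormal D u = inner ℝ u p - inner ℝ u q ∧
      ∀ x ∈ D, inner ℝ u x ≤ inner ℝ u p ∧ inner ℝ u q ≤ inner ℝ u x := by
  have hc : ContinuousOn (fun x : Plane => inner ℝ u x) D := by fun_prop
  obtain ⟨p, hp, h1, h2⟩ := hD.exists_sSup_image_eq_and_ge hne hc
  obtain ⟨q, hq, h3, h4⟩ := hD.exists_sInf_image_eq_and_le hne hc
  exact ⟨p, hp, q, hq, by rw [widthNormal, h1, h3], fun x hx => ⟨h2 x hx, h4 x hx⟩⟩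

lemma widthNormal_nonneg {D : Set Plane} (hD : IsCompact D) (hne : D.Nonempty) (u : Plane) :
    0 ≤ widthNormal D u := by
  obtain ⟨p, -, q, hq, h, h'⟩ := exists_extreme_points hD hne u
  linarith [(h' q hq).1]

lemma continuous_widthNormal {D : Set Plane} (hD : IsCompact D) : Continuous (widthNormal D) := by
  have h : Continuous ↿(fun u x : Plane => (inner ℝ u x : ℝ)) := by
    change Continuous fun y : Plane × Plane => (inner ℝ y.1 y.2 : ℝ)
    fun_prop
  exact (hD.continuous_sSup h).sub (hD.continuous_sInf h)

/-- In a direction of minimal width, the width is attained by a chord parallel to it. -/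
lemma exists_width_chord {D : Set Plane} (hD : IsCompact D) (hne : D.Nonempty)
    (hconv : Convex ℝ D) {u : Plane} (hu : ‖u‖ = 1)
    (hmin : ∀ v : Plane, ‖v‖ = 1 → widthNormal D u ≤ widthNormal D v) :
    ∃ p ∈ D, ∃ q ∈ D, p - q = widthNormal D u • u := by
  by_contra hno
  have hmem : widthNormal D u • u ∉ D - D := by
    rintro ⟨p, hp, q, hq, h⟩
    exact hno ⟨p, hp, q, hq, h⟩
  have hDD : IsCompact (D - D) := by
    rw [← Set.sub_image_prod]
    exact (hD.prod hD).image continuous_sub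
  -- The support function of D − D is the width of D, so the normal of a separating line is a
  -- direction of smaller width.
  obtain ⟨f, s, hf, hfs⟩ := geometric_hahn_banach_closed_point (hconv.sub hconv)
    hDD.isClosed hmem
  set z : Plane := (InnerProductSpace.toDual ℝ Plane).symm f with hz
  have hfz : ∀ x, f x = inner ℝ z x := fun x => by
    rw [hz, InnerProductSpace.toDual_symm_apply]
  have hz0 : z ≠ 0 := by
    intro h0
    obtain ⟨a, ha⟩ := hne
    have h1 := (hf _ (Set.sub_mem_sub ha ha)).trans hfs
    rw [hfz, hfz, h0, inner_zero_left, inner_zero_left] at h1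
    exact lt_irrefl _ h1
  have hzpos : 0 < ‖z‖ := norm_pos_iff.2 hz0
  have hv : ‖‖z‖⁻¹ • z‖ = 1 := norm_smul_inv_norm hz0
  obtain ⟨p, hp, q, hq, h1, -⟩ := exists_extreme_points hD hne (‖z‖⁻¹ • z)
  have h2 := (hf _ (Set.sub_mem_sub hp hq)).trans hfs
  have h3 := hmin _ hv
  rw [h1, ← inner_sub_right, real_inner_smul_left, ← div_eq_inv_mul, le_div_iff₀ hzpos] at h3
  rw [hfz, hfz, inner_smul_right] at h2
  have h4 : inner ℝ z u ≤ ‖z‖ := by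
    simpa [hu] using real_inner_le_norm z u
  nlinarith [mul_le_mul_of_nonneg_left h4 (widthNormal_nonneg hD hne u)]

/-! ### The lower bound -/

/-- Lower bound for the minimal width of an intersection of finitely many unit disks. -/
lemma le_minimalWidth_diskInter {S : Set Plane} (hS : S.Finite) (hSne : S.Nonempty) {θ : ℝ}
    (hθ1 : Real.pi / 6 ≤ θ) (hθ2 : θ < Real.pi / 3)
    (hd : ∀ c ∈ S, ∀ c' ∈ S, dist c c' ≤ 2 * Real.sin θ)
    {o : Plane} (ho : ∀ c ∈ S, dist o c < 1) :
    1 + Real.cos θ - √3 * Real.sin θ ≤ minimalWidth (diskInter S) := by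
  have hpi := Real.pi_pos
  have hD := isCompact_diskInter hSne
  have hne : (diskInter S).Nonempty := ⟨o, mem_diskInter.2 fun c hc => (ho c hc).le⟩
  have hsph : (sphere (0 : Plane) 1).Nonempty := NormedSpace.sphere_nonempty.2 zero_le_one
  obtain ⟨u, hu, hmin⟩ := (isCompact_sphere (0 : Plane) 1).exists_isMinOn hsph
    (continuous_widthNormal hD).continuousOn
  refine le_trans ?_ (le_csInf (hsph.image _) (Set.forall_mem_image.2 fun v hv => hmin hv))
  rw [mem_sphere_zero_iff_norm] at hu
  obtain ⟨p, hp, q, hq, hpq⟩ := exists_width_chord hD hne (convex_diskInter S) hu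
    fun v hv => hmin (mem_sphere_zero_iff_norm.2 hv)
  set t := widthNormal (diskInter S) u with ht
  have ht0 : 0 ≤ t := widthNormal_nonneg hD hne u
  have hpqu : inner ℝ u p - inner ℝ u q = t := by
    rw [← inner_sub_right, hpq, inner_smul_right, inner_self_of_unit hu, mul_one]
  have hpqv : inner ℝ (quarterTurn u) p - inner ℝ (quarterTurn u) q = 0 := by
    rw [← inner_sub_right, hpq, inner_smul_right, inner_quarterTurn_self, mul_zero]
  obtain ⟨p', hp', q', hq', h1, h2⟩ := exists_extreme_points hD hne u
  rw [← ht] at h1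
  -- The chord is as long as the width, so its endpoints lie on the two supporting lines.
  have hpmax : ∀ x ∈ diskInter S, inner ℝ u x ≤ inner ℝ u p := fun x hx => by
    linarith [(h2 x hx).1, (h2 q hq).2]
  have hqmax : ∀ x ∈ diskInter S, inner ℝ (-u) x ≤ inner ℝ (-u) q := fun x hx => by
    rw [inner_neg_left, inner_neg_left]
    linarith [(h2 x hx).2, (h2 p hp).1]
  obtain ⟨c₁, hc₁, c₂, hc₂, α₁, α₂, hα₁, hα₂, hα, ha, hb, hc, hd'⟩ :=
    exists_normal_angles hS (by linarith) hd ho hp hu hpmax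
  obtain ⟨e₁, he₁, e₂, he₂, β₁, β₂, hβ₁, hβ₂, hβ, ha', hb', hc', hd''⟩ :=
    exists_normal_angles hS (by linarith) hd ho hq (by rwa [norm_neg]) hqmax
  rw [quarterTurn_neg] at hb' hd''
  rw [inner_neg_left] at ha' hb' hc' hd''
  rw [inner_sub_right] at ha hb hc hd' ha' hb' hc' hd''
  have hdist : ∀ c ∈ S, ∀ e ∈ S, (inner ℝ u c - inner ℝ u e) ^ 2 +
      (inner ℝ (quarterTurn u) c - inner ℝ (quarterTurn u) e) ^ 2 ≤ 4 * Real.sin θ ^ 2 := by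
    intro c hc e he
    rw [← inner_sub_right, ← inner_sub_right, ← norm_sq_eq_frame hu, ← dist_eq_norm]
    have := pow_le_pow_left₀ dist_nonneg (hd c hc e he) 2
    linarith
  have k₁ : inner ℝ u c₁ = inner ℝ u p - Real.cos α₁ := by linarith
  have k₂ : inner ℝ u c₂ = inner ℝ u p - Real.cos α₂ := by linarith
  have l₁ : inner ℝ (quarterTurn u) c₁ = inner ℝ (quarterTurn u) p - Real.sin α₁ := by linarith
  have l₂ : inner ℝ (quarterTurn u) c₂ = inner ℝ (quarterTurn u) p + Real.sin α₂ := by linarith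
  have m₁ : inner ℝ u e₁ = inner ℝ u p - t + Real.cos β₁ := by linarith
  have m₂ : inner ℝ u e₂ = inner ℝ u p - t + Real.cos β₂ := by linarith
  have n₁ : inner ℝ (quarterTurn u) e₁ = inner ℝ (quarterTurn u) p + Real.sin β₁ := by linarith
  have n₂ : inner ℝ (quarterTurn u) e₂ = inner ℝ (quarterTurn u) p - Real.sin β₂ := by linarith
  have h11 := hdist c₁ hc₁ e₁ he₁
  have h22 := hdist c₂ hc₂ e₂ he₂
  have h12 := hdist c₁ hc₁ e₂ he₂
  have h21 := hdist c₂ hc₂ e₁ he₁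
  rw [k₁, m₁, l₁, n₁] at h11
  rw [k₂, m₂, l₂, n₂] at h22
  rw [k₁, m₂, l₁, n₂] at h12
  rw [k₂, m₁, l₂, n₁] at h21
  refine le_center_distance hθ1 hθ2 ht0 hα₁ hα₂ hβ₁ hβ₂ hα hβ ?_ ?_ ?_ ?_
  · linear_combination h11
  · linear_combination h22
  · linear_combination h12
  · linear_combination h21

/-! ### The regular disk-triangle -/

/-- The centroid of a triangle of side `d < √3` lies inside the unit disks at its vertices. -/
lemma dist_centroid_lt_one {a b c : Plane} {d : ℝ} (hd : d ^ 2 < 3) (hab : dist a b = d)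
    (hbc : dist b c = d) (hca : dist c a = d) :
    dist ((1 / 3 : ℝ) • (a + b + c)) a < 1 := by
  rw [dist_eq_norm] at *
  have h1 : ‖(b - a) + (c - a)‖ ^ 2 = ‖b - a‖ ^ 2 + 2 * inner ℝ (b - a) (c - a) + ‖c - a‖ ^ 2 :=
    norm_add_sq_real _ _
  have h2 : ‖(b - a) - (c - a)‖ ^ 2 = ‖b - a‖ ^ 2 - 2 * inner ℝ (b - a) (c - a) + ‖c - a‖ ^ 2 :=
    norm_sub_sq_real _ _
  rw [show (b - a) - (c - a) = b - c by abel, hbc, hca, norm_sub_rev b a, hab] at h2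
  rw [hca, norm_sub_rev b a, hab] at h1
  rw [show (1 / 3 : ℝ) • (a + b + c) - a = (1 / 3 : ℝ) • ((b - a) + (c - a)) by module, norm_smul,
    Real.norm_of_nonneg (by norm_num)]
  nlinarith [norm_nonneg ((b - a) + (c - a))]

/-- Apollonius' identity. -/
lemma norm_sub_midpoint_sq (x b c : Plane) :
    ‖x - (1 / 2 : ℝ) • (b + c)‖ ^ 2 =
      (dist x b ^ 2 + dist x c ^ 2) / 2 - dist b c ^ 2 / 4 := by
  have h1 := norm_add_sq_real (x - b) (x - c)
  have h2 := norm_sub_sq_real (x - b) (x - c)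
  rw [show x - b - (x - c) = -(b - c) by abel, norm_neg] at h2
  rw [show x - (1 / 2 : ℝ) • (b + c) = (1 / 2 : ℝ) • ((x - b) + (x - c)) by module, norm_smul,
    Real.norm_of_nonneg (by norm_num), mul_pow, dist_eq_norm, dist_eq_norm, dist_eq_norm]
  linarith

/-- The width of the regular disk-triangle orthogonal to a side of its center triangle. -/
lemma minimalWidth_triangle_le {a b c o : Plane} {θ : ℝ} (hcos : 0 ≤ Real.cos θ)
    (hsin : 0 < Real.sin θ) (hab : dist a b = 2 * Real.sin θ) (hbc : dist b c = 2 * Real.sin θ)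
    (hca : dist c a = 2 * Real.sin θ) (ho : o ∈ diskInter {a, b, c}) :
    minimalWidth (diskInter {a, b, c}) ≤ 1 + Real.cos θ - √3 * Real.sin θ := by
  have hs3 : √3 ^ 2 = 3 := Real.sq_sqrt (by norm_num)
  have hD : IsCompact (diskInter {a, b, c}) := isCompact_diskInter ⟨a, by simp⟩
  have hne : (diskInter {a, b, c}).Nonempty := ⟨o, ho⟩
  set m : Plane := (1 / 2 : ℝ) • (b + c) with hm
  have ham : ‖a - m‖ = √3 * Real.sin θ := by
    have h1 := norm_sub_midpoint_sq a b c
    rw [dist_comm a c, hab, hbc, hca, ← hm] at h1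
    have h2 : ‖a - m‖ ^ 2 = (√3 * Real.sin θ) ^ 2 := by
      rw [mul_pow, hs3]; linarith
    exact (sq_eq_sq₀ (norm_nonneg _) (by positivity)).1 h2
  have hpos : 0 < ‖a - m‖ := by rw [ham]; positivity
  set u : Plane := ‖a - m‖⁻¹ • (a - m) with hu
  have hu1 : ‖u‖ = 1 := norm_smul_inv_norm (norm_pos_iff.1 hpos)
  have huam : inner ℝ u (a - m) = √3 * Real.sin θ := by
    rw [hu, real_inner_smul_left, real_inner_self_eq_norm_sq, ← ham]
    field_simp
  have hbdd : BddBelow (widthNormal (diskInter {a, b, c}) '' sphere (0 : Plane) 1) :=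
    ⟨0, Set.forall_mem_image.2 fun v _ => widthNormal_nonneg hD hne v⟩
  refine (csInf_le hbdd ⟨u, mem_sphere_zero_iff_norm.2 hu1, rfl⟩).trans ?_
  obtain ⟨p, hp, q, hq, h1, -⟩ := exists_extreme_points hD hne u
  rw [h1]
  rw [mem_diskInter] at hp hq
  -- The lens of the disks around b and c lies in the disk of radius cos θ around m.
  have hpm : ‖p - m‖ ≤ Real.cos θ := by
    have h2 := norm_sub_midpoint_sq p b c
    have h3 := pow_le_pow_left₀ dist_nonneg (hp b (by simp)) 2
    have h4 := pow_le_pow_left₀ dist_nonneg (hp c (by simp)) 2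
    rw [hbc, ← hm] at h2
    have h5 : ‖p - m‖ ^ 2 ≤ Real.cos θ ^ 2 := by
      linarith [Real.sin_sq_add_cos_sq θ]
    exact (sq_le_sq₀ (norm_nonneg _) hcos).1 h5
  have hqa : ‖a - q‖ ≤ 1 := by
    rw [← dist_eq_norm, dist_comm]; exact hq a (by simp)
  have h6 := real_inner_le_norm u (p - m)
  have h7 := real_inner_le_norm u (a - q)
  rw [hu1, one_mul, inner_sub_right] at h6 h7
  rw [inner_sub_right] at huam
  linarith

/-- The outer radicand is the square of 2(√3 sin θ − cos θ), nonnegative by `hw`. -/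
lemma width_formula {θ : ℝ} (hcos : 0 ≤ Real.cos θ) (hw : Real.cos θ ≤ √3 * Real.sin θ) :
    1 - 1 / 2 * √(4 + 2 * (2 * Real.sin θ) ^ 2 -
      2 * √3 * (2 * Real.sin θ) * √(4 - (2 * Real.sin θ) ^ 2)) =
      1 + Real.cos θ - √3 * Real.sin θ := by
  have hs3 : √3 ^ 2 = 3 := Real.sq_sqrt (by norm_num)
  have h := Real.sin_sq_add_cos_sq θ
  have h1 : √(4 - (2 * Real.sin θ) ^ 2) = 2 * Real.cos θ := by
    rw [show 4 - (2 * Real.sin θ) ^ 2 = (2 * Real.cos θ) ^ 2 by linear_combination -4 * h]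
    exact Real.sqrt_sq (by linarith)
  rw [h1, show 4 + 2 * (2 * Real.sin θ) ^ 2 - 2 * √3 * (2 * Real.sin θ) * (2 * Real.cos θ) =
    (2 * (√3 * Real.sin θ - Real.cos θ)) ^ 2 by
      linear_combination -4 * h - 4 * Real.sin θ ^ 2 * hs3, Real.sqrt_sq (by linarith)]
  ring

theorem lemma2 (d : ℝ) (hd1 : 1 ≤ d) (hd2 : d < Real.sqrt 3)
    (D : Set Plane) (hD : D ∈ diskPolygonFamily d)
    (T : Set Plane) (hT : IsRegularDiskTriangle d T) :
    minimalWidth T ≤ minimalWidth D ∧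
      minimalWidth T =
        1 - 1 / 2 * Real.sqrt (4 + 2 * d ^ 2 - 2 * Real.sqrt 3 * d * Real.sqrt (4 - d ^ 2)) := by
  have hs3 : √3 ^ 2 = 3 := Real.sq_sqrt (by norm_num)
  have hpi := Real.pi_pos
  have hdsq : d ^ 2 < 3 := by nlinarith
  obtain ⟨θ, hθ1, hθ2, rfl⟩ : ∃ θ, Real.pi / 6 ≤ θ ∧ θ < Real.pi / 3 ∧ d = 2 * Real.sin θ := by
    refine ⟨Real.arcsin (d / 2), ?_, ?_, ?_⟩
    · rw [Real.le_arcsin_iff_sin_le' ⟨by linarith, by linarith⟩, Real.sin_pi_div_six]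
      linarith
    · rw [Real.arcsin_lt_iff_lt_sin' ⟨by linarith, by linarith⟩, Real.sin_pi_div_three]
      linarith
    · rw [Real.sin_arcsin (by linarith) (by nlinarith)]
      ring
  have hcos : 0 ≤ Real.cos θ :=
    Real.cos_nonneg_of_neg_pi_div_two_le_of_le (by linarith) (by linarith)
  have hw : Real.cos θ ≤ √3 * Real.sin θ := by linarith [width_le_one hθ1 hθ2.le]
  obtain ⟨a, b, c, hab, hbc, hca, rfl⟩ := hT
  rw [width_formula hcos hw]
  have hoT : ∀ e ∈ ({a, b, c} : Set Plane), dist ((1 / 3 : ℝ) • (a + b + c)) e < 1 := by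
    rintro e (rfl | rfl | rfl)
    · exact dist_centroid_lt_one hdsq hab hbc hca
    · rw [show a + e + c = e + c + a by abel]
      exact dist_centroid_lt_one hdsq hbc hca hab
    · rw [show a + b + e = e + a + b by abel]
      exact dist_centroid_lt_one hdsq hca hab hbc
  have hdT : ∀ e ∈ ({a, b, c} : Set Plane), ∀ e' ∈ ({a, b, c} : Set Plane),
      dist e e' ≤ 2 * Real.sin θ := by
    rintro e (rfl | rfl | rfl) e' (rfl | rfl | rfl) <;>
      first
      | (rw [dist_self]; linarith)
      | (simp only [hab, hbc, hca]; done)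
      | (rw [dist_comm]; simp only [hab, hbc, hca, le_refl])
      | simp only [hab, hbc, hca, le_refl]
  have hTeq : minimalWidth (diskInter {a, b, c}) = 1 + Real.cos θ - √3 * Real.sin θ :=
    le_antisymm
      (minimalWidth_triangle_le hcos (by linarith) hab hbc hca
        (mem_diskInter.2 fun e he => (hoT e he).le))
      (le_minimalWidth_diskInter (by simp) ⟨a, by simp⟩ hθ1 hθ2 hdT hoT)
  refine ⟨?_, hTeq⟩
  obtain ⟨S, hS, hdS⟩ := hD
  obtain ⟨o, ho⟩ := hS.interior_nonempty
  rw [hTeq, hS.eq_inter]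
  refine le_minimalWidth_diskInter hS.finite hS.nonempty hθ1 hθ2 hdS (o := o) fun e he => ?_
  have hsub : D ⊆ closedBall e 1 := hS.eq_inter ▸ Set.biInter_subset_of_mem he
  have h := interior_mono hsub ho
  rwa [interior_closedBall e one_ne_zero, mem_ball] at h
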